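/- Let $r:\mathbb{N}\to\mathbb{N}$ (with $\mathbb{N}=\{1,2,\dots\}$) be a valid rate function, i.e. $r$ is nondecreasing and $1\le r(n)\le n$ for all $n$. Then there is a probability measure $\mu$ on $\mathcal{X}^{\mathbb{N}}$, where $\mathcal{X}=\{0,1\}^{\mathbb{N}}$, such that $$\limsup_{n\to\infty}\frac{R_\mu(n)}{r(n)}=1 .$$ Here $R_\mu(n)=\|\Delta_n(\mu)\|_\infty$ is the $\eta$-mixing rate of $\mu$: if $(X_1,X_2,\dots)$ has law $\mu$, then $\Delta_n(\mu)$ is the upper triangular $n\times n$ matrix with unit diagonal and with entries $$\bar\eta^{(n)}_{ij}=\sup_{y\in\mathcal{X}^{i-1},\;w,w'\in\mathcal{X}}\bigl\|\mathcal{L}(X_j,\dots,X_n\mid (X_1,\dots,X_i)=yw)-\mathcal{L}(X_j,\dots,X_n\mid (X_1,\dots,X_i)=yw')\bigr\|_{TV}\qquad(1\le i<j\le n),$$ $\|\cdot\|_\infty$ is the $\ell_\infty$ operator norm (the maximal absolute row sum), $\|\nu\|_{TV}=\tfrac12|\nu|(\text{whole space})$ is half the total variation of a signed measure, $\mathcal{L}(\cdot\mid\cdot)$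 denotes regular conditional distributions, and, since these are determined only up to null sets, the supremum is essential: it is the least $c\ge 0$ for which there is a set $G\subseteq\mathcal{X}^i$ of full measure under the law of $(X_1,\dots,X_i)$ such that the norm above is at most $c$ whenever $yw\in G$ and $yw'\in G$. -/

import Mathlib

open MeasureTheory ProbabilityTheory Filter

noncomputable section

/-- The total variation norm `½‖ν‖₁` of a signed measure (with the factor `1/2`). -/
def tvNorm {Ω : Type*} [MeasurableSpace Ω] (ν : SignedMeasure Ω) : ℝ :=
  (ν.totalVariation Set.univ).toReal / 2

section EtaMixing

variable {X : Type*} [MeasurableSpace X] [StandardBorelSpace X] [Nonempty X]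

/-- The regular conditional distribution of `(x_j, …, x_{n-1})` given `(x_0, …, x_i) = z`, for `x`
distributed according to the measure `P` on `X^n` (coordinates are indexed by `0, …, n-1`). -/
def condLaw {n : ℕ} (P : Measure (Fin n → X)) [IsProbabilityMeasure P] (i j : Fin n)
    (z : Set.Iic i → X) : Measure (Set.Ici j → X) :=
  condDistrib (fun (x : Fin n → X) (l : Set.Ici j) => x l)
    (fun (x : Fin n → X) (l : Set.Iic i) => x l) P z

instance isProbabilityMeasure_condLaw {n : ℕ} (P : Measure (Fin n → X)) [IsProbabilityMeasure P] (i j : Fin n)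
    (z : Set.Iic i → X) : IsProbabilityMeasure (condLaw P i j z) := by
  unfold condLaw
  infer_instance

/-- `η_ij(y, w, w')` for the two histories `z = y w` and `z' = y w'`. -/
def eta {n : ℕ} (P : Measure (Fin n → X)) [IsProbabilityMeasure P] (i j : Fin n)
    (z z' : Set.Iic i → X) : ℝ :=
  tvNorm ((condLaw P i j z).toSignedMeasure - (condLaw P i j z').toSignedMeasure)

/-- The coefficient `η̄_ij`, i.e. the supremum of `η_ij(y, w, w')` over all histories `y w`, `y w'`
that agree except possibly in their last letter.
Conditional laws are determined only up to null sets of histories, so the supremum is taken up to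
null sets: the least `c` such that `η_ij(y, w, w') ≤ c` whenever `y w` and `y w'` both lie in some
fixed set `G` of histories of full measure. On a countable state space this is the supremum over
those `y, w, w'` for which `y w` and `y w'` both have positive probability. -/
def etaBar {n : ℕ} (P : Measure (Fin n → X)) [IsProbabilityMeasure P] (i j : Fin n) : ℝ :=
  sInf {c : ℝ | 0 ≤ c ∧
    ∃ G ∈ ae (P.map fun (x : Fin n → X) (l : Set.Iic i) => x l),
      ∀ z ∈ G, ∀ z' ∈ G, (∀ l : Set.Iic i, (l : Fin n) < i → z l = z' l) → eta P i j z z' ≤ c}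

/-- The upper triangular matrix `Δ` with unit diagonal and entries `η̄_ij` for `i < j`. -/
def etaMatrix {n : ℕ} (P : Measure (Fin n → X)) [IsProbabilityMeasure P] :
    Matrix (Fin n) (Fin n) ℝ :=
  Matrix.of fun i j => if i = j then 1 else if i < j then etaBar P i j else 0

/-- The marginal distribution of the first `n` coordinates of a process. -/
def initialMarginal (μ : Measure (ℕ → X)) (n : ℕ) : Measure (Fin n → X) :=
  μ.map fun (x : ℕ → X) (k : Fin n) => x k

instance isProbabilityMeasure_initialMarginal (μ : Measure (ℕ → X)) [IsProbabilityMeasure μ] (n : ℕ) :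
    IsProbabilityMeasure (initialMarginal μ n) :=
  Measure.isProbabilityMeasure_map 
    (measurable_pi_lambda (fun (x : ℕ → X) (k : Fin n) => x k)
      fun k => measurable_pi_apply (k : ℕ)).aemeasurable

attribute [local instance] Matrix.linftyOpNormedAddCommGroup

/-- The `η`-mixing rate `R_μ(n) = ‖Δ_n(μ)‖_∞` of a process, with the `ℓ_∞` operator norm. -/
def mixingRate (μ : Measure (ℕ → X)) [IsProbabilityMeasure μ] (n : ℕ) : ℝ :=
  ‖etaMatrix (initialMarginal μ n)‖

end EtaMixing

/-- Valid rate functions, with time running through the positive integers. -/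
def IsValidRate (r : ℕ → ℕ) : Prop :=
  MonotoneOn r (Set.Ici 1) ∧ ∀ n, 1 ≤ n → 1 ≤ r n ∧ r n ≤ n

end

/-! Cut time into consecutive intervals and repeat one fair coin throughout each block, with
independent coins for different blocks. The coefficient at `i < j` is 1 if `i` starts the block of
`j` (`etaBar_blockProcess_eq_one`) and 0 otherwise (`etaBar_blockProcess_eq_zero`), so the mixing
rate at `n` is the length of the longest block, truncated at time `n`. If every block can be ended
at the last moment before its length exceeds `r`, the rate stays below `r` and meets it whenever a
block ends (`exists_isBlockStart_le_rate`). Otherwise some `a` has `n - a ≤ r n` for all `n`; then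
`r n` is asymptotic to `n`, and a single infinite block, whose rate is `n`, suffices. -/

/-! ### Total variation distance between probability measures. -/

section TotalVariation

variable {Ω : Type*} [MeasurableSpace Ω]

theorem tvNorm_eq_real_add_real (ν : SignedMeasure Ω) :
    tvNorm ν = (ν.toJordanDecomposition.posPart.real Set.univ +
      ν.toJordanDecomposition.negPart.real Set.univ) / 2 := by
  rw [tvNorm, ← measureReal_def, SignedMeasure.totalVariation, measureReal_add_apply]

theorem tvNorm_toSignedMeasure_sub_le_one (μ ν : Measure Ω) [IsProbabilityMeasure μ]
    [IsProbabilityMeasure ν] : tvNorm (μ.toSignedMeasure - ν.toSignedMeasure) ≤ 1 := by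
  obtain ⟨i, hi, hi₂, hi₃, hp, hn⟩ :=
    (μ.toSignedMeasure - ν.toSignedMeasure).toJordanDecomposition_spec
  rw [tvNorm_eq_real_add_real, hp, hn,
    SignedMeasure.toMeasureOfZeroLE_real_apply _ hi₂ hi MeasurableSet.univ,
    SignedMeasure.toMeasureOfLEZero_real_apply _ hi₃ hi.compl MeasurableSet.univ]
  simp only [Set.inter_univ]
  rw [Measure.toSignedMeasure_sub_apply hi, Measure.toSignedMeasure_sub_apply hi.compl]
  have h1 := measureReal_nonneg (μ := ν) (s := i)
  have h2 := measureReal_nonneg (μ := μ) (s := iᶜ)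
  have h3 := measureReal_le_one (μ := μ) (s := i)
  have h4 := measureReal_le_one (μ := ν) (s := iᶜ)
  linarith

/-- The difference has value 1 on `A` and -1 on `Aᶜ`, so its positive and negative parts each have
mass at least 1. -/
theorem one_le_tvNorm_toSignedMeasure_sub {μ ν : Measure Ω} [IsProbabilityMeasure μ]
    [IsProbabilityMeasure ν] {A : Set Ω} (hA : MeasurableSet A) (hμ : μ A = 1) (hν : ν A = 0) :
    1 ≤ tvNorm (μ.toSignedMeasure - ν.toSignedMeasure) := by
  set s := μ.toSignedMeasure - ν.toSignedMeasure with hs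
  have h1 := s.apply_eq_posPart_real_sub_negPart_real hA
  have h2 := s.apply_eq_posPart_real_sub_negPart_real hA.compl
  rw [hs, Measure.toSignedMeasure_sub_apply hA, ← hs] at h1
  rw [hs, Measure.toSignedMeasure_sub_apply hA.compl, ← hs, probReal_compl_eq_one_sub hA,
    probReal_compl_eq_one_sub hA] at h2
  rw [tvNorm_eq_real_add_real, ← measureReal_add_measureReal_compl hA,
    ← measureReal_add_measureReal_compl (μ := s.toJordanDecomposition.negPart) hA]
  have hμ' : μ.real A = 1 := by simp [measureReal_def, hμ]
  have hν' : ν.real A = 0 := by simp [measureReal_def, hν]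
  rw [hμ', hν'] at h1 h2
  have h3 := measureReal_nonneg (μ := s.toJordanDecomposition.posPart) (s := Aᶜ)
  have h4 := measureReal_nonneg (μ := s.toJordanDecomposition.negPart) (s := A)
  linarith

theorem tvNorm_zero : tvNorm (0 : SignedMeasure Ω) = 0 := by
  simp [tvNorm, SignedMeasure.totalVariation_zero]

end TotalVariation

theorem condDistrib_ae_eq_map_of_indepFun {Ω α β : Type*} [MeasurableSpace Ω] [MeasurableSpace α]
    [MeasurableSpace β] [StandardBorelSpace β] [Nonempty β] {P : Measure Ω}
    [IsProbabilityMeasure P] {U : Ω → α} {V : Ω → β} (hU : Measurable U) (hV : Measurable V)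
    (h : IndepFun U V P) : ∀ᵐ u ∂(P.map U), condDistrib V U P u = P.map V := by
  have := Measure.isProbabilityMeasure_map hV.aemeasurable (μ := P)
  have key := condDistrib_ae_eq_of_measure_eq_compProd (μ := P) U hV.aemeasurable
    (κ := Kernel.const α (P.map V)) (by
      rw [Measure.compProd_const]
      exact (indepFun_iff_map_prod_eq_prod_map_map hU.aemeasurable hV.aemeasurable).1 h)
  filter_upwards [key] with u hu
  rw [hu, Kernel.const_apply]

/-! ### Mixing coefficients of a general process. -/

section EtaMixing

variable {X : Type*} [MeasurableSpace X] [StandardBorelSpace X] [Nonempty X]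
  {n : ℕ} (P : Measure (Fin n → X)) [IsProbabilityMeasure P] (i j : Fin n)

theorem eta_le_one (z z' : Set.Iic i → X) : eta P i j z z' ≤ 1 :=
  tvNorm_toSignedMeasure_sub_le_one _ _

variable {i j} in
theorem eta_eq_zero {z z' : Set.Iic i → X} (h : condLaw P i j z = condLaw P i j z') :
    eta P i j z z' = 0 := by
  have h' : (condLaw P i j z).toSignedMeasure = (condLaw P i j z').toSignedMeasure := by
    congr 1
  rw [eta, h', sub_self, tvNorm_zero]

theorem etaBar_nonneg : 0 ≤ etaBar P i j := Real.sInf_nonneg fun _ h => h.1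

theorem etaBar_le_one : etaBar P i j ≤ 1 :=
  csInf_le ⟨0, fun _ h => h.1⟩
    ⟨zero_le_one, Set.univ, univ_mem, fun _ _ _ _ _ => eta_le_one P i j _ _⟩

variable {i j} in
theorem etaBar_eq_zero {p : (Set.Iic i → X) → Prop}
    (hp : ∀ᵐ z ∂(P.map fun (x : Fin n → X) (l : Set.Iic i) => x l), p z)
    (h : ∀ z z', p z → p z' → (∀ l : Set.Iic i, (l : Fin n) < i → z l = z' l) →
      condLaw P i j z = condLaw P i j z') : etaBar P i j = 0 :=
  le_antisymm
    (csInf_le ⟨0, fun _ h => h.1⟩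
      ⟨le_rfl, {z | p z}, hp, fun z hz z' hz' hzz => (eta_eq_zero P (h z z' hz hz' hzz)).le⟩)
    (etaBar_nonneg P i j)

variable {i j} in
/-- If the letter at time `i` can be read off at time `j`, and two histories of positive mass differ
in their last letter only, then `η̄_ij = 1`. -/
theorem etaBar_eq_one (hP : ∀ᵐ x ∂P, x j = x i) {z z' : Set.Iic i → X}
    (hz : P.map (fun (x : Fin n → X) (l : Set.Iic i) => x l) {z} ≠ 0)
    (hz' : P.map (fun (x : Fin n → X) (l : Set.Iic i) => x l) {z'} ≠ 0)
    (hlt : ∀ l : Set.Iic i, (l : Fin n) < i → z l = z' l)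
    (hne : z ⟨i, Set.self_mem_Iic⟩ ≠ z' ⟨i, Set.self_mem_Iic⟩) : etaBar P i j = 1 := by
  refine le_antisymm (etaBar_le_one P i j) (le_csInf
    ⟨1, zero_le_one, Set.univ, univ_mem, fun _ _ _ _ _ => eta_le_one P i j _ _⟩ ?_)
  rintro c ⟨-, G, hG, hc⟩
  set U : (Fin n → X) → Set.Iic i → X := fun x l => x l
  set V : (Fin n → X) → Set.Ici j → X := fun x l => x l
  have hU : Measurable U := by fun_prop
  have hV : Measurable V := by fun_prop
  set e : (Set.Ici j → X) → X := fun v => v ⟨j, Set.self_mem_Ici⟩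
  set f : (Set.Iic i → X) → X := fun u => u ⟨i, Set.self_mem_Iic⟩
  have he : Measurable e := measurable_pi_apply _
  have hf : Measurable f := measurable_pi_apply _
  have h1 := condDistrib_comp (mβ := MeasurableSpace.pi) (μ := P) U hV.aemeasurable he
  have h2 := condDistrib_comp_self (mβ := MeasurableSpace.pi) (μ := P) U hf
  have h3 : condDistrib (e ∘ V) U P = condDistrib (f ∘ U) U P := condDistrib_congr_left hP
  -- Given the history, `x j = x i` is already determined.
  have hlaw : ∀ᵐ u ∂(P.map U), (condLaw P i j u).map e = Measure.dirac (f u) := by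
    filter_upwards [h1, h2] with u hu1 hu2
    rw [← Kernel.deterministic_apply hf, ← hu2, ← h3, hu1, Kernel.map_apply _ he]
    rfl
  -- An atom lies in every set of full measure, so no choice of `G` can avoid `z` and `z'`.
  have mem_of_pos : ∀ u, P.map U {u} ≠ 0 → u ∈ G ∧
      (condLaw P i j u).map e = Measure.dirac (f u) := by
    intro u hu
    by_contra hcon
    have hae : ∀ᵐ v ∂(P.map U), v ∈ G ∧ (condLaw P i j v).map e = Measure.dirac (f v) :=
      Filter.Eventually.and hG hlaw
    exact hu (measure_mono_null (Set.singleton_subset_iff.2 hcon) (ae_iff.1 hae))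
  obtain ⟨hzG, hzl⟩ := mem_of_pos z hz
  obtain ⟨hzG', hzl'⟩ := mem_of_pos z' hz'
  refine le_trans ?_ (hc z hzG z' hzG' hlt)
  have hs : MeasurableSet {f z} := measurableSet_singleton _
  refine one_le_tvNorm_toSignedMeasure_sub (he hs) ?_ ?_
  · rw [← Measure.map_apply he hs, hzl]
    simp
  · rw [← Measure.map_apply he hs, hzl', Measure.dirac_apply' _ hs]
    exact Set.indicator_of_notMem (fun h => hne h.symm) _

end EtaMixing

/-! ### Partitions of time into intervals. -/

section BlockStarts

/-- `s n` is the first time of the block containing `n`, in a partition of `ℕ` into intervals. -/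
def IsBlockStart (s : ℕ → ℕ) : Prop := s 0 = 0 ∧ ∀ n, s (n + 1) = s n ∨ s (n + 1) = n + 1

variable {s : ℕ → ℕ}

theorem IsBlockStart.le (hs : IsBlockStart s) (n : ℕ) : s n ≤ n := by
  induction n with
  | zero => exact hs.1.le
  | succ n ih => rcases hs.2 n with h | h <;> omega

theorem IsBlockStart.monotone (hs : IsBlockStart s) : Monotone s :=
  monotone_nat_of_le_succ fun n => by
    have := hs.le n
    rcases hs.2 n with h | h <;> omega

theorem IsBlockStart.idem (hs : IsBlockStart s) (n : ℕ) : s (s n) = s n := by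
  induction n with
  | zero => rw [hs.1, hs.1]
  | succ n ih =>
    rcases hs.2 n with h | h
    · rw [h, ih]
    · rw [h, h]

end BlockStarts

/-! ### Mixing rate of block processes. -/

section BlockProcess

variable {X : Type*} [MeasurableSpace X]

/-- The uniform distribution on two points. -/
noncomputable def fairCoin (a b : X) : Measure X :=
  (2⁻¹ : ENNReal) • (Measure.dirac a + Measure.dirac b)

instance isProbabilityMeasure_fairCoin (a b : X) : IsProbabilityMeasure (fairCoin a b) := by
  constructor
  simp only [fairCoin, Measure.smul_apply, Measure.add_apply, measure_univ, smul_eq_mul,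
    one_add_one_eq_two]
  exact ENNReal.inv_mul_cancel (by simp) (by simp)

theorem fairCoin_singleton_ne_zero [MeasurableSingletonClass X] {a b x : X} (hx : x = a ∨ x = b) :
    fairCoin a b {x} ≠ 0 := by
  rcases hx with rfl | rfl <;> simp [fairCoin]

/-- The process that is constant on blocks, with independent letters distributed as `ν` on the
different blocks. -/
noncomputable def blockProcess (ν : Measure X) (s : ℕ → ℕ) : Measure (ℕ → X) :=
  (Measure.infinitePi fun _ : ℕ => ν).map fun ω k => ω (s k)

variable (ν : Measure X) (s : ℕ → ℕ)

instance isProbabilityMeasure_blockProcess [IsProbabilityMeasure ν] : IsProbabilityMeasure (blockProcess ν s) :=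
  Measure.isProbabilityMeasure_map (by fun_prop : Measurable _).aemeasurable

theorem initialMarginal_blockProcess (n : ℕ) : initialMarginal (blockProcess ν s) n =
    (Measure.infinitePi fun _ : ℕ => ν).map fun ω (k : Fin n) => ω (s k) := by
  rw [initialMarginal, blockProcess, Measure.map_map (by fun_prop) (by fun_prop)]
  rfl

variable {ν s} {n : ℕ} {i j : Fin n}

theorem ae_initialMarginal_blockProcess_eq [StandardBorelSpace X] {k l : Fin n}
    (h : s k = s l) : ∀ᵐ x ∂(initialMarginal (blockProcess ν s) n), x k = x l := by
  have hm : MeasurableSet {x : Fin n → X | x k = x l} :=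
    measurableSet_eq_fun (by fun_prop) (by fun_prop)
  rw [initialMarginal_blockProcess, ae_map_iff (by fun_prop : Measurable _).aemeasurable hm]
  simp [h]

theorem ae_history_blockProcess_eq [StandardBorelSpace X] {k l : Set.Iic i}
    (h : s (k : Fin n) = s (l : Fin n)) :
    ∀ᵐ z ∂((initialMarginal (blockProcess ν s) n).map
      fun (x : Fin n → X) (l : Set.Iic i) => x l), z k = z l := by
  have hm : MeasurableSet {z : Set.Iic i → X | z k = z l} :=
    measurableSet_eq_fun (by fun_prop) (by fun_prop)
  rw [ae_map_iff (by fun_prop : Measurable _).aemeasurable hm]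
  exact ae_initialMarginal_blockProcess_eq h

variable [IsProbabilityMeasure ν]

/-- The history reads only coins with index at most `i`, the future only coins with index above `i`.
-/
theorem indepFun_history_future_blockProcess (hs : IsBlockStart s) (h : (i : ℕ) < s j) :
    IndepFun (fun (x : Fin n → X) (l : Set.Iic i) => x l)
      (fun (x : Fin n → X) (l : Set.Ici j) => x l) (initialMarginal (blockProcess ν s) n) := by
  have hind := (iIndepFun_infinitePi (P := fun _ : ℕ => ν) (X := fun _ ω => ω)
    (fun _ => measurable_id)).indepFun_finset (Finset.Iic (i : ℕ)) (Finset.Ioo (i : ℕ) n)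
    (by
      rw [Finset.disjoint_left]
      intro k hk hk'
      simp only [Finset.mem_Iic, Finset.mem_Ioo] at hk hk'
      omega) (fun k => by fun_prop)
  have hle : ∀ l : Set.Iic i, s (l : Fin n) ∈ Finset.Iic (i : ℕ) := fun l =>
    Finset.mem_Iic.2 ((hs.le _).trans l.2)
  have hge : ∀ l : Set.Ici j, s (l : Fin n) ∈ Finset.Ioo (i : ℕ) n := fun l =>
    Finset.mem_Ioo.2 ⟨h.trans_le (hs.monotone l.2), (hs.le _).trans_lt (l : Fin n).2⟩
  have hind' := hind.comp
    (φ := fun (u : Finset.Iic (i : ℕ) → X) (l : Set.Iic i) => u ⟨s (l : Fin n), hle l⟩)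
    (ψ := fun (u : Finset.Ioo (i : ℕ) n → X) (l : Set.Ici j) => u ⟨s (l : Fin n), hge l⟩)
    (by fun_prop) (by fun_prop)
  have hT : Measurable fun (ω : ℕ → X) (k : Fin n) => ω (s k) := by fun_prop
  rw [initialMarginal_blockProcess]
  have := Measure.isProbabilityMeasure_map (μ := Measure.infinitePi fun _ : ℕ => ν) hT.aemeasurable
  have hU : Measurable fun (x : Fin n → X) (l : Set.Iic i) => x l := by fun_prop
  have hV : Measurable fun (x : Fin n → X) (l : Set.Ici j) => x l := by fun_prop
  rw [indepFun_iff_map_prod_eq_prod_map_map hU.aemeasurable hV.aemeasurable,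
    Measure.map_map hU hT, Measure.map_map hV hT, Measure.map_map (hU.prodMk hV) hT]
  exact (indepFun_iff_map_prod_eq_prod_map_map (hU.comp hT).aemeasurable
    (hV.comp hT).aemeasurable).1 hind'

theorem map_history_blockProcess_singleton_ne_zero [MeasurableSingletonClass X]
    (hs : IsBlockStart s) {g : ℕ → X} (hg : ∀ k, ν {g k} ≠ 0) :
    (initialMarginal (blockProcess ν s) n).map (fun (x : Fin n → X) (l : Set.Iic i) => x l)
      {(fun l => g (s (l : Fin n)) : Set.Iic i → X)} ≠ 0 := by
  rw [initialMarginal_blockProcess, Measure.map_map (by fun_prop) (by fun_prop),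
    Measure.map_apply (by fun_prop) (measurableSet_singleton _)]
  -- Fixing the finitely many coins up to time `i` already determines the history.
  refine ne_bot_of_le_ne_bot (b := Measure.infinitePi (fun _ : ℕ => ν)
    (Set.pi (Finset.Iic (i : ℕ)) fun k => {g k})) ?_ (measure_mono fun ω hω => ?_)
  · rw [Measure.infinitePi_pi _ fun k _ => measurableSet_singleton _]
    exact Finset.prod_ne_zero_iff.2 fun k _ => hg k
  · ext l
    exact hω _ (Finset.mem_coe.2 (Finset.mem_Iic.2 ((hs.le _).trans l.2)))

variable [StandardBorelSpace X] [Nonempty X]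

/-- If `i` starts a block, that block ends before `j` and the future is independent of the history.
If not, the last letter almost surely copies an earlier one, so histories agreeing before `i`
coincide. -/
theorem etaBar_blockProcess_eq_zero (hs : IsBlockStart s) (hij : i < j) (h : s j ≠ i) :
    etaBar (initialMarginal (blockProcess ν s) n) i j = 0 := by
  by_cases hi : s i = i
  · have hlt : (i : ℕ) < s j := lt_of_le_of_ne (hi ▸ hs.monotone hij.le) h.symm
    refine etaBar_eq_zero _ (condDistrib_ae_eq_map_of_indepFun (by fun_prop) (by fun_prop)
      (indepFun_history_future_blockProcess hs hlt)) fun z z' hz hz' _ => ?_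
    exact hz.trans hz'.symm
  · have hlt : s i < i := lt_of_le_of_ne (hs.le i) hi
    let k : Set.Iic i := ⟨⟨s i, hlt.trans i.2⟩, hlt.le⟩
    refine etaBar_eq_zero _ (ae_history_blockProcess_eq (k := ⟨i, Set.self_mem_Iic⟩) (l := k)
      (hs.idem i).symm) fun z z' hz hz' hzz => ?_
    congr 1
    ext l
    rcases (show (l : Fin n) ≤ i from l.2).lt_or_eq with hl | hl
    · exact hzz l hl
    · have : l = ⟨i, Set.self_mem_Iic⟩ := Subtype.ext hl
      rw [this, hz, hz', hzz k hlt]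

theorem etaBar_blockProcess_eq_one (hs : IsBlockStart s) {a b : X} (hab : a ≠ b)
    (h : s j = i) : etaBar (initialMarginal (blockProcess (fairCoin a b) s) n) i j = 1 := by
  have hi : s i = i := h ▸ hs.idem j
  have hpos : ∀ g : ℕ → X, (∀ k, g k = a ∨ g k = b) → ∀ k, fairCoin a b {g k} ≠ 0 :=
    fun g hg k => fairCoin_singleton_ne_zero (hg k)
  refine etaBar_eq_one _ (ae_initialMarginal_blockProcess_eq (h.trans hi.symm))
    (map_history_blockProcess_singleton_ne_zero hs (hpos (fun _ => a) fun _ => Or.inl rfl))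
    -- The second history flips only coin `i`, which no earlier time reads.
    (map_history_blockProcess_singleton_ne_zero hs
      (hpos (Function.update (fun _ => a) i b) fun k => ?_)) (fun l hl => ?_) ?_
  · by_cases hk : k = i
    · simp [hk]
    · simp [hk]
  · have : s (l : Fin n) ≠ i := ((hs.le _).trans_lt hl).ne
    simp [this]
  · simpa [hi] using hab

/-- Off the diagonal, row `i` is supported on those `j` whose block starts at `i`. -/
theorem mixingRate_blockProcess_le (hs : IsBlockStart s) {C : ℕ} (hC : 1 ≤ C)
    (h : ∀ j < n, j + 1 - s j ≤ C) : mixingRate (blockProcess ν s) n ≤ C := by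
  let := Matrix.linftyOpNormedAddCommGroup (m := Fin n) (n := Fin n) (α := ℝ)
  rw [mixingRate, Matrix.linfty_opNorm_def, ← NNReal.coe_natCast, NNReal.coe_le_coe]
  refine Finset.sup_le fun i _ => ?_
  calc ∑ j, ‖etaMatrix (initialMarginal (blockProcess ν s) n) i j‖₊
      ≤ ∑ j : Fin n, if i ≤ j ∧ (j : ℕ) < i + C then 1 else 0 := by
        refine Finset.sum_le_sum fun j _ => ?_
        rw [etaMatrix, Matrix.of_apply]
        rcases lt_trichotomy i j with hij | rfl | hij
        · rw [if_neg hij.ne, if_pos hij]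
          by_cases hj : s j = i
          · have := h j j.2
            rw [if_pos ⟨hij.le, by omega⟩, ← NNReal.coe_le_coe, coe_nnnorm, Real.norm_eq_abs,
              abs_of_nonneg (etaBar_nonneg _ _ _)]
            exact etaBar_le_one _ _ _
          · simp [etaBar_blockProcess_eq_zero hs hij hj]
        · simp [show 0 < C from hC]
        · simp [hij.ne', hij.not_gt]
    _ = ((Finset.univ.filter fun j : Fin n => i ≤ j ∧ (j : ℕ) < i + C).card : NNReal) := by
        simp
    _ ≤ C := by
        refine Nat.cast_le.2 ?_
        calc _ ≤ (Finset.Ico (i : ℕ) (i + C)).card :=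
              Finset.card_le_card_of_injOn Fin.val
                (fun j hj => by simpa using hj) Fin.val_injective.injOn
          _ = C := by simp

/-- The row of the start of the last block consists of ones from the diagonal on. -/
theorem le_mixingRate_blockProcess (hs : IsBlockStart s) {a b : X} (hab : a ≠ b) (m : ℕ) :
    ((m + 1 - s m : ℕ) : ℝ) ≤ mixingRate (blockProcess (fairCoin a b) s) (m + 1) := by
  let := Matrix.linftyOpNormedAddCommGroup (m := Fin (m + 1)) (n := Fin (m + 1)) (α := ℝ)
  rw [mixingRate, Matrix.linfty_opNorm_def, ← NNReal.coe_natCast, NNReal.coe_le_coe]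
  let i : Fin (m + 1) := ⟨s m, Nat.lt_succ_of_le (hs.le m)⟩
  refine le_trans ?_ (Finset.le_sup (Finset.mem_univ i))
  calc ((m + 1 - s m : ℕ) : NNReal) = ((Finset.Ici i).card : NNReal) := by simp [i]
    _ = ∑ j ∈ Finset.Ici i, 1 := by simp
    _ ≤ ∑ j ∈ Finset.Ici i,
        ‖etaMatrix (initialMarginal (blockProcess (fairCoin a b) s) (m + 1)) i j‖₊ := by
        refine Finset.sum_le_sum fun j hj => ?_
        have hij : i ≤ j := Finset.mem_Ici.1 hj
        rw [etaMatrix, Matrix.of_apply]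
        rcases hij.eq_or_lt with h | h
        · simp [h]
        · have hsj : s j = i := le_antisymm (hs.monotone (Nat.le_of_lt_succ j.2))
            ((hs.idem m).symm.trans_le (hs.monotone hij))
          simp [h.ne, h, etaBar_blockProcess_eq_one hs hab hsj]
    _ ≤ _ := Finset.sum_le_univ_sum_of_nonneg fun _ => zero_le

end BlockProcess

/-! ### Greedy choice of the blocks. -/

section RateFunctions

theorem exists_next_block_of_not_le {r : ℕ → ℕ} (hr : IsValidRate r) {a n : ℕ}
    (h : r n < n - a) :
    ∃ b, a < b ∧ r b = b - a ∧ ∀ m, m ≤ b → m - a ≤ r m := by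
  classical
  have hex : ∃ n, r n < n - a := ⟨n, h⟩
  obtain ⟨hspec, hmin⟩ : r (Nat.find hex) < Nat.find hex - a ∧
      ∀ m < Nat.find hex, m - a ≤ r m :=
    ⟨Nat.find_spec hex, fun m hm => not_lt.1 (Nat.find_min hex hm)⟩
  generalize Nat.find hex = k at hspec hmin
  -- `b + 1` is the first violation, so `b - a ≤ r b ≤ r (b + 1) < b + 1 - a` forces equality at
  -- `b`. Since `r (b + 1) ≥ 1`, also `b > a`, so monotonicity is applied at positive times only.
  obtain ⟨b, rfl⟩ : ∃ b, k = b + 1 := ⟨k - 1, by omega⟩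
  have h1 := (hr.2 (b + 1) (by omega)).1
  have h2 : r b ≤ r (b + 1) := hr.1 (Set.mem_Ici.2 (by omega)) (Set.mem_Ici.2 (by omega)) (by omega)
  have h3 := hmin b (by omega)
  exact ⟨b, by omega, by omega, fun m hm => hmin m (by omega)⟩

theorem exists_isBlockStart_le_rate {r : ℕ → ℕ} (hr : IsValidRate r)
    (h : ∀ a, ∃ n, r n < n - a) :
    ∃ s, IsBlockStart s ∧ (∀ m, m + 1 - s m ≤ r (m + 1)) ∧
      ∀ N, ∃ m ≥ N, m + 1 - s m = r (m + 1) := by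
  choose e he hre hle using fun a => exists_next_block_of_not_le hr (h a).choose_spec
  -- A block starting at `a` occupies the times from `a` to `e a - 1`; the next one starts at `e a`.
  let s : ℕ → ℕ := fun n => Nat.rec 0 (fun n t => if e t = n + 1 then n + 1 else t) n
  have hs1 : ∀ n, s (n + 1) = if e (s n) = n + 1 then n + 1 else s n := fun n => rfl
  have hs : IsBlockStart s := ⟨rfl, fun n => by rw [hs1]; split_ifs <;> simp⟩
  have hlt : ∀ n, n < e (s n) := by
    intro n
    induction n with
    | zero => exact he 0
    | succ n ih =>
      rw [hs1]
      split_ifs with hn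
      · exact he _
      · omega
  refine ⟨s, hs, fun m => hle (s m) (m + 1) (hlt m), fun N => ?_⟩
  -- The block containing `N` runs until `e (s N) - 1`, where its length equals the rate.
  have hconst : ∀ k, N + k < e (s N) → s (N + k) = s N := by
    intro k
    induction k with
    | zero => simp
    | succ k ih =>
      intro hk
      rw [← add_assoc, hs1, ih (by omega), if_neg (by omega)]
  have hN := hlt N
  obtain ⟨k, hk⟩ : ∃ k, e (s N) = N + k + 1 := ⟨e (s N) - N - 1, by omega⟩
  refine ⟨N + k, by omega, ?_⟩
  rw [hconst k (by omega), ← hk, hre]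

/-- The ratio is squeezed between 1 and `n / (n - a)`. -/
theorem tendsto_natCast_div_of_sub_le {r : ℕ → ℕ} (hr : IsValidRate r) {a : ℕ}
    (h : ∀ n, n - a ≤ r n) : Tendsto (fun n : ℕ => (n : ℝ) / r n) atTop (nhds 1) := by
  have hlim : Tendsto (fun n : ℕ => (n : ℝ) / ((n : ℝ) + (-a : ℝ))) atTop (nhds 1) :=
    tendsto_natCast_div_add_atTop (-a : ℝ)
  refine tendsto_of_tendsto_of_tendsto_of_le_of_le' tendsto_const_nhds hlim ?_ ?_
  · filter_upwards [eventually_ge_atTop 1] with n hn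
    obtain ⟨h1, h2⟩ := hr.2 n hn
    rw [one_le_div (by exact_mod_cast h1)]
    exact_mod_cast h2
  · filter_upwards [eventually_gt_atTop a] with n hn
    have h1 : (n : ℝ) - a ≤ r n := by
      rw [← Nat.cast_sub hn.le]
      exact_mod_cast h n
    have h2 : (a : ℝ) < n := by exact_mod_cast hn
    gcongr
    · linarith
    · linarith

end RateFunctions

/-! ### The limsup of the ratio. -/

theorem exists_limsup_mixingRate_div_eq_one {X : Type*} [MeasurableSpace X] [StandardBorelSpace X]
    [Nontrivial X] {r : ℕ → ℕ} (hr : IsValidRate r) :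
    ∃ (μ : Measure (ℕ → X)) (_ : IsProbabilityMeasure μ),
      limsup (fun n : ℕ => ((mixingRate μ n / (r n : ℝ) : ℝ) : EReal)) atTop = 1 := by
  obtain ⟨a, b, hab⟩ := exists_pair_ne X
  -- The alternative is whether a block started at some `a` could run forever.
  by_cases h : ∃ a, ∀ n, n - a ≤ r n
  · obtain ⟨c, hc⟩ := h
    have hs : IsBlockStart fun _ => 0 := ⟨rfl, fun _ => Or.inl rfl⟩
    refine ⟨blockProcess (fairCoin a b) fun _ => 0, inferInstance, Tendsto.limsup_eq ?_⟩
    refine (continuous_coe_real_ereal.tendsto (1 : ℝ)).comp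
      ((tendsto_natCast_div_of_sub_le hr hc).congr' ?_)
    filter_upwards [eventually_ge_atTop 1] with n hn
    obtain ⟨m, rfl⟩ : ∃ m, n = m + 1 := ⟨n - 1, by omega⟩
    congr 1
    exact le_antisymm (le_mixingRate_blockProcess hs hab m)
      (mixingRate_blockProcess_le hs hn fun j hj => by omega)
  · push Not at h
    obtain ⟨s, hs, hle, heq⟩ := exists_isBlockStart_le_rate hr h
    refine ⟨blockProcess (fairCoin a b) s, inferInstance, le_antisymm ?_ ?_⟩
    · refine limsup_le_of_le (by isBoundedDefault) ?_
      filter_upwards [eventually_ge_atTop 1] with n hn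
      have h1 := (hr.2 n hn).1
      rw [← EReal.coe_one, EReal.coe_le_coe_iff, div_le_one (by exact_mod_cast h1)]
      refine mixingRate_blockProcess_le hs h1 fun j hj => (hle j).trans (hr.1 ?_ ?_ hj)
      · exact Set.mem_Ici.2 (by omega)
      · exact Set.mem_Ici.2 hn
    · refine le_limsup_of_frequently_le (frequently_atTop.2 fun N => ?_) (by isBoundedDefault)
      obtain ⟨m, hm, hrm⟩ := heq N
      refine ⟨m + 1, by omega, ?_⟩
      have h1 := (hr.2 (m + 1) (by omega)).1
      rw [← EReal.coe_one, EReal.coe_le_coe_iff, one_le_div (by exact_mod_cast h1), ← hrm]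
      exact le_mixingRate_blockProcess hs hab m

theorem corollary1 (r : ℕ → ℕ) (hr : IsValidRate r) :
    ∃ (μ : Measure (ℕ → (ℕ → Bool))) (_ : IsProbabilityMeasure μ),
      limsup (fun n : ℕ => ((mixingRate μ n / (r n : ℝ) : ℝ) : EReal)) atTop = 1 :=
  exists_limsup_mixingRate_div_eq_one hr
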